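/- **Setting.** A *generalized probability distance* $(\mathcal D,\preceq,D)$ consists of a poset $(\mathcal D,\preceq)$ and a map $D$ that assigns to any two random variables $X,X'$ with values in the same measurable space an element $D(X,X')\in\mathcal D$ depending only on their laws, such that (post-processing) $D(g(X),g(X'))\preceq D(X,X')$ for every measurable $g$, and (joint convexity) if $D(X_i,X'_i)\preceq d$ for all $i\in\mathcal I$ and $I$ is a random index in $\mathcal I$ independent of the $X_i$, $X'_i$ (the laws of $X_i$, $X_i'$ depending measurably on $i$), then $D(X_I,X'_I)\preceq d$. * $(\mathcal D,\preceq)$ is *complete* if every nonempty subset has a supremum. A map $f:\mathcal D\to\mathcal D$ is *continuous* if $f(\sup S)=\sup f(S)$ for every nonempty $S\subseteq\mathcal D$; a map of finitely many variables is *continuous in each variable* if it is continuous in each variable when the others are fixed. * $D$ has the *coupling property* at $d$ if for all random variables $X,X'$ on one standard Borel space and $Y,Y'$ on another with $D(X,X')\preceq d$ and $D(Y,Y')\preceq d$ there are a coupling $(X,Y)$ of $X$ and $Y$ and a coupling $(X',Y')$ of $X'$ and $Y'$ such that $D((X,Y),(X',Y'))\preceq d$. * $D$ satisfies the *chain rule*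 if for all finitely supported random variables $X,X'$ on the same domain there is a function $\mathrm{ChainRule}_{X,X'}:\mathcal D^{\mathrm{supp}(X)\cap\mathrm{supp}(X')}\to\mathcal D$, continuous in each variable, such that $D((X,Y),(X',Y'))=\mathrm{ChainRule}_{X,X'}\big((D(Y|_{X=x},Y'|_{X'=x}))_{x}\big)$ for all $Y$ jointly distributed with $X$ and $Y'$ jointly distributed with $X'$, with values in the same space. A *non-interactive mechanism* on a set $\mathcal X$ of datasets with a binary neighboring relation assigns to each $x\in\mathcal X$ a random variable $\mathcal M(x)$ in a fixed measurable space; it is *$d$-$\mathcal D$ DP* if $D(\mathcal M(x),\mathcal M(x'))\preceq d$ whenever $x$ and $x'$ are neighboring. $\mathrm{Comp}(\mathcal M_1,\dots,\mathcal M_k)(x)=(\mathcal M_1(x),\dots,\mathcal M_k(x))$ with independent coins. A message is a binary string or the symbol $\mathtt{halt}$. An *interactive mechanism* $\mathcal M$ on $\mathcal X$ gives its next message as a function of the dataset, the strings received so far and its random coins; an *adversary* $B$ gives its next message as a function of the strings received so far and its random coins. The coins are drawn once, at the start, from arbitrary probability spaces, independently for $B$ and $\mathcal M$. In the interaction, $B$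 and $\mathcal M$ send messages alternately, $B$ first, until one of them sends $\mathtt{halt}$. The *view* $\mathrm{View}(B\leftrightarrow\mathcal M(x))$ consists of the coins of $B$ and all messages that $B$ receives. $\mathcal M$ is *$d$-$\mathcal D$ DP* if $D(\mathrm{View}(B\leftrightarrow\mathcal M(x)),\mathrm{View}(B\leftrightarrow\mathcal M(x')))\preceq d$ for all adversaries $B$ and all neighboring $x,x'$. $\mathcal M$ has *finite communication* if for every $x$ there is a constant $c$ such that, for all coins and all received strings, $\mathcal M(x)$ replies $\mathtt{halt}$ as soon as it has received more than $c$ strings or a string of more than $c$ bits, and otherwise has sent at most $c$ bits in total. Fix any rule that parses binary strings as pairs $(j,q)$ of an index $j\in\{1,\dots,k\}$ and a string $q$ (or fails). For interactive mechanisms $\mathcal M_j$ on $\mathcal X_j$, the *concurrent composition* $\mathrm{ConComp}(\mathcal M_1,\dots,\mathcal M_k)$ is the interactive mechanism on $\mathcal X_1\times\dots\times\mathcal X_k$ (two tuples being neighboring if they are neighboring in every coordinate) with independent coins for the $\mathcal M_j$, which parses the last message as $(j,q)$ and outputs the reply of $\mathcal M_j$, with its dataset $x_j$ and its coins, to the sequence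 of all queries addressed to $\mathcal M_j$ so far; if the last message cannot be parsed, it outputs $\mathtt{halt}$. **Theorem.** Let $(\mathcal D,\preceq,D)$ be a generalized probability distance such that $(\mathcal D,\preceq)$ is complete, $D$ satisfies the chain rule, and $D$ has the coupling property at every $d\in\mathcal D$. Let $k\in\mathbb N$ and $d_1,\dots,d_k,d\in\mathcal D$. Suppose that for all non-interactive mechanisms $\mathcal N_1,\dots,\mathcal N_k$ (on any common set of datasets with any neighboring relation) such that $\mathcal N_i$ is $d_i$-$\mathcal D$ DP for $i=1,\dots,k$, the composition $\mathrm{Comp}(\mathcal N_1,\dots,\mathcal N_k)$ is $d$-$\mathcal D$ DP. Then for all interactive mechanisms $\mathcal M_1,\dots,\mathcal M_k$ with finite communication such that $\mathcal M_i$ is $d_i$-$\mathcal D$ DP for $i=1,\dots,k$, the concurrent composition $\mathrm{ConComp}(\mathcal M_1,\dots,\mathcal M_k)$ is $d$-$\mathcal D$ DP. -/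

import Mathlib

open MeasureTheory ProbabilityTheory

/-! ### Generalized probability distances -/

/-- A generalized probability distance with values in a poset `𝒟`. A random variable enters only
through its law, so `dist μ ν` is the distance of two random variables with laws `μ` and `ν`;
only its values on probability measures matter. -/
structure GeneralizedDistance (𝒟 : Type*) [PartialOrder 𝒟] where
  dist : ∀ {α : Type} [MeasurableSpace α], Measure α → Measure α → 𝒟
  post_processing : ∀ {α β : Type} [MeasurableSpace α] [MeasurableSpace β]
    (μ ν : Measure α) [IsProbabilityMeasure μ] [IsProbabilityMeasure ν] (g : α → β),
    Measurable g → dist (μ.map g) (ν.map g) ≤ dist μ ν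
  /-- If `I` has law `π` and the pairs `(X_i, X'_i)` have laws `(κ i, κ' i)`, then `X_I` and `X'_I`
  have the mixtures `π.bind κ` and `π.bind κ'` as laws. -/
  joint_convexity : ∀ {ι α : Type} [MeasurableSpace ι] [MeasurableSpace α]
    (π : Measure ι) [IsProbabilityMeasure π] (κ κ' : Kernel ι α)
    [IsMarkovKernel κ] [IsMarkovKernel κ'] (d : 𝒟),
    (∀ i, dist (κ i) (κ' i) ≤ d) → dist (π.bind κ) (π.bind κ') ≤ d

/-- Every nonempty subset has a supremum. -/
def IsCompletePoset (𝒟 : Type*) [PartialOrder 𝒟] : Prop :=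
  ∀ S : Set 𝒟, S.Nonempty → ∃ s, IsLUB S s

/-- `f (sup S) = sup (f S)` for every (nonempty) set `S`. -/
def SupContinuous {A B : Type*} [PartialOrder A] [PartialOrder B] (f : A → B) : Prop :=
  ∀ S : Set A, S.Nonempty → ∀ s, IsLUB S s → IsLUB (f '' S) (f s)

open Classical in
/-- Continuity in each variable, the other variables being fixed. -/
def SupContinuousInEach {S A B : Type*} [PartialOrder A] [PartialOrder B]
    (f : (S → A) → B) : Prop :=
  ∀ (i : S) (a : S → A), SupContinuous fun y => f (Function.update a i y)

/-- The law of `Y` conditioned on `X = x`, where `ρ` is the law of `(X, Y)`. -/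
noncomputable def condLaw {α β : Type} [MeasurableSpace α] [MeasurableSpace β]
    (ρ : Measure (α × β)) (x : α) : Measure β :=
  (ProbabilityTheory.cond ρ (Prod.fst ⁻¹' {x})).map Prod.snd

namespace GeneralizedDistance

variable {𝒟 : Type*} [PartialOrder 𝒟]

/-- The coupling property at every `d`. -/
def CouplingProperty (D : GeneralizedDistance 𝒟) : Prop :=
  ∀ (d : 𝒟) (α β : Type) [MeasurableSpace α] [StandardBorelSpace α]
    [MeasurableSpace β] [StandardBorelSpace β]
    (μ μ' : Measure α) (ν ν' : Measure β)
    [IsProbabilityMeasure μ] [IsProbabilityMeasure μ']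
    [IsProbabilityMeasure ν] [IsProbabilityMeasure ν'],
    D.dist μ μ' ≤ d → D.dist ν ν' ≤ d →
    ∃ ρ ρ' : Measure (α × β), IsProbabilityMeasure ρ ∧ IsProbabilityMeasure ρ' ∧
      ρ.map Prod.fst = μ ∧ ρ.map Prod.snd = ν ∧
      ρ'.map Prod.fst = μ' ∧ ρ'.map Prod.snd = ν' ∧
      D.dist ρ ρ' ≤ d

/-- The chain rule: for all laws `μ`, `μ'` of finitely supported random variables `X`, `X'` there
is a function `C`, continuous in each variable, that computes the distance of `(X, Y)` and
`(X', Y')` from the distances of the conditional laws on the common support. -/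
def ChainRule (D : GeneralizedDistance 𝒟) : Prop :=
  ∀ (α : Type) [MeasurableSpace α] [MeasurableSingletonClass α]
    (μ μ' : Measure α) [IsProbabilityMeasure μ] [IsProbabilityMeasure μ'],
    (∃ F : Set α, F.Finite ∧ μ Fᶜ = 0 ∧ μ' Fᶜ = 0) →
    ∃ C : ({x : α // μ {x} ≠ 0 ∧ μ' {x} ≠ 0} → 𝒟) → 𝒟, SupContinuousInEach C ∧
      ∀ (β : Type) [MeasurableSpace β] (ρ ρ' : Measure (α × β))
        [IsProbabilityMeasure ρ] [IsProbabilityMeasure ρ'],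
        ρ.map Prod.fst = μ → ρ'.map Prod.fst = μ' →
        D.dist ρ ρ' = C fun x => D.dist (condLaw ρ x.1) (condLaw ρ' x.1)

end GeneralizedDistance

/-! ### Non-interactive mechanisms -/

/-- A randomized algorithm on datasets in `X`, given by its output laws. -/
structure NonInteractiveMechanism (X : Type*) where
  Out : Type
  [measurableSpace : MeasurableSpace Out]
  law : X → Measure Out
  [isProbabilityMeasure : ∀ x, IsProbabilityMeasure (law x)]

attribute [instance] NonInteractiveMechanism.measurableSpace
attribute [instance] NonInteractiveMechanism.isProbabilityMeasure

namespace NonInteractiveMechanism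

variable {X : Type*} {𝒟 : Type*} [PartialOrder 𝒟]

/-- `d`-`𝒟` DP with respect to the neighboring relation `nbr`. -/
def IsDP (M : NonInteractiveMechanism X) (D : GeneralizedDistance 𝒟)
    (nbr : X → X → Prop) (d : 𝒟) : Prop :=
  ∀ x x', nbr x x' → D.dist (M.law x) (M.law x') ≤ d

/-- `Comp(M₁, …, M_k)(x) = (M₁(x), …, M_k(x))`, with independent coins. -/
noncomputable def comp {k : ℕ} (M : Fin k → NonInteractiveMechanism X) :
    NonInteractiveMechanism X where
  Out := ∀ j, (M j).Out
  law x := Measure.pi fun j => (M j).law x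

end NonInteractiveMechanism

/-! ### Interactive protocols -/

/-- A message is a binary string or the symbol `halt`. -/
inductive Message where
  | halt : Message
  | str : List Bool → Message

namespace Message

/-- The bit length of a message (`halt` carries no bits). -/
def bitLength : Message → ℕ
  | halt => 0
  | str s => s.length

instance : MeasurableSpace Message := ⊤

instance : MeasurableSpace (Option Message) := ⊤

instance : DiscreteMeasurableSpace Message := ⟨fun _ => trivial⟩

instance : DiscreteMeasurableSpace (Option Message) := ⟨fun _ => trivial⟩

end Message

/-- An interactive mechanism on datasets in `X`. Its next message is a function of the dataset, the
strings received so far (in order) and its random coins, which are drawn once, at the beginning. -/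
structure InteractiveMechanism (X : Type*) where
  Coins : Type
  [measurableSpace : MeasurableSpace Coins]
  coinLaw : Measure Coins
  [isProbabilityMeasure : IsProbabilityMeasure coinLaw]
  reply : X → List (List Bool) → Coins → Message
  measurable_reply : ∀ x qs, Measurable (reply x qs)

attribute [instance] InteractiveMechanism.measurableSpace
attribute [instance] InteractiveMechanism.isProbabilityMeasure

/-- An adversary. Its next message is a function of the strings received so far (in order) and its
random coins. -/
structure Adversary where
  Coins : Type
  [measurableSpace : MeasurableSpace Coins]
  coinLaw : Measure Coins
  [isProbabilityMeasure : IsProbabilityMeasure coinLaw]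
  send : List (List Bool) → Coins → Message
  measurable_send : ∀ as, Measurable (send as)

attribute [instance] Adversary.measurableSpace
attribute [instance] Adversary.isProbabilityMeasure

namespace InteractiveMechanism

variable {X : Type*}

/-- The interaction of the adversary `B` with coins `rB` and the mechanism `M` with coins `rM`, in
which `B` moves first. The value at `t` is `some (qs, as)` if nobody has sent `halt` in the first
`t` exchanges, where `qs` are the strings sent by `B` and `as` are those sent by `M`; it is `none`
if the loop was exited. -/
def run (B : Adversary) (M : InteractiveMechanism X) (x : X) (rB : B.Coins) (rM : M.Coins) :
    ℕ → Option (List (List Bool) × List (List Bool))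
  | 0 => some ([], [])
  | t + 1 =>
    match run B M x rB rM t with
    | none => none
    | some (qs, as) =>
      match B.send as rB with
      | .halt => none
      | .str q =>
        match M.reply x (qs ++ [q]) rM with
        | .halt => none
        | .str a => some (qs ++ [q], as ++ [a])

/-- The message (possibly `halt`) that the adversary receives in exchange `t`; `none` if the loop
was exited before. -/
def received (B : Adversary) (M : InteractiveMechanism X) (x : X) (rB : B.Coins) (rM : M.Coins)
    (t : ℕ) : Option Message :=
  match run B M x rB rM t with
  | none => none
  | some (qs, as) =>
    match B.send as rB with
    | .halt => none
    | .str q => some (M.reply x (qs ++ [q]) rM)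

/-- The law of the view of the adversary: its coins and the sequence of messages it receives. -/
noncomputable def view (B : Adversary) (M : InteractiveMechanism X) (x : X) :
    Measure (B.Coins × (ℕ → Option Message)) :=
  (B.coinLaw.prod M.coinLaw).map fun r => (r.1, received B M x r.1 r.2)

/-- `d`-`𝒟` DP with respect to the neighboring relation `nbr`. -/
def IsDP {𝒟 : Type*} [PartialOrder 𝒟] (M : InteractiveMechanism X) (D : GeneralizedDistance 𝒟)
    (nbr : X → X → Prop) (d : 𝒟) : Prop :=
  ∀ (B : Adversary) (x x' : X), nbr x x' → D.dist (view B M x) (view B M x') ≤ d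

/-- Finite communication: for every dataset there is a bound `c` such that `M` halts when it has
received more than `c` strings or a string of more than `c` bits, and otherwise has sent at most
`c` bits so far (in its replies to the nonempty prefixes of the sequence of strings received). -/
def FiniteCommunication (M : InteractiveMechanism X) : Prop :=
  ∀ x, ∃ c : ℕ, ∀ (r : M.Coins) (qs : List (List Bool)),
    ((c < qs.length ∨ ∃ q ∈ qs, c < q.length) → M.reply x qs r = .halt) ∧
    ((qs.length ≤ c ∧ ∀ q ∈ qs, q.length ≤ c) →
      ∑ j ∈ Finset.range qs.length, (M.reply x (qs.take (j + 1)) r).bitLength ≤ c)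

/-- The strings addressed to mechanism `j`, where `parse m = some (j, q)` if the string `m` is a
query `q` to mechanism `j`, and `parse m = none` if `m` cannot be parsed. -/
def queriesTo {k : ℕ} (parse : List Bool → Option (Fin k × List Bool)) (j : Fin k)
    (ms : List (List Bool)) : List (List Bool) :=
  ms.filterMap fun m => (parse m).bind fun p => if p.1 = j then some p.2 else none

/-- The reply of the concurrent composition to the messages `ms`, the last one being the current
one, where mechanism `j` has dataset `x j` and coins `r j`. -/
def conCompReply {k : ℕ} {X : Fin k → Type*} (parse : List Bool → Option (Fin k × List Bool))
    (M : ∀ j, InteractiveMechanism (X j)) (x : ∀ j, X j) (ms : List (List Bool))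
    (r : ∀ j, (M j).Coins) : Message :=
  match ms.getLast?.bind parse with
  | none => .halt
  | some (j, _) => (M j).reply (x j) (queriesTo parse j ms) (r j)

/-- `ConComp(M₁, …, M_k)`: the coins of the mechanisms are independent. -/
noncomputable def conComp {k : ℕ} {X : Fin k → Type*}
    (parse : List Bool → Option (Fin k × List Bool))
    (M : ∀ j, InteractiveMechanism (X j)) : InteractiveMechanism (∀ j, X j) where
  Coins := ∀ j, (M j).Coins
  coinLaw := Measure.pi fun j => (M j).coinLaw
  reply := conCompReply parse M
  measurable_reply x ms := by
    unfold conCompReply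
    cases h : ms.getLast?.bind parse with
    | none => exact measurable_const
    | some p => exact ((M p.1).measurable_reply _ _).comp (measurable_pi_apply p.1)

end InteractiveMechanism

/-! ### Deterministic strategies -/

/-! Fixing the coins turns a mechanism on a dataset into a deterministic strategy, so a mechanism on
`x` is a law on `ReplyTable`. For neighboring `x`, `x'` these laws are close as seen by every
adversary, but not necessarily as laws of whole tables: an adversary explores only one path of
queries. The key claim, `IsClose.exists_tables`, is that they can be replaced by laws `τ`, `τ'` that
no path of queries tells apart from them (`PathEquiv`) and that are `d_j`-close as laws of whole
tables. Sampling from `τ` or `τ'` is then a non-interactive mechanism on a two-point dataset, and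
the hypothesis on `Comp` applies. The view against the concurrent composition is recovered by
post-processing the independent tables for fixed adversary coins; joint convexity averages over
these coins (`dist_view_le`). This is legitimate because observable equality determines views
(`PathEquiv.map_received_eq`) and survives concurrent composition (`PathEquiv.conc`).

The tables are built by induction on the number of queries. For a fixed first query, let `s m` be
the supremum, over the adversaries' continuations, of the distances that remain after reply `m`.
Induction gives tables within `s m`. By the chain rule, reply and table together are at distance at
most `C s`, and continuity in each variable bounds `C s` by the values of `C` at individual choices
of continuations. Each such value is the distance of the views of one adversary, hence at most `d`
(`exists_reply_and_table`). Finally the coupling property joins the finitely many admissible first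
queries in one table. -/

instance : Countable Message :=
  Function.Injective.countable (f := fun m : Message => match m with
    | .halt => (none : Option (List Bool))
    | .str s => some s) <| by
    rintro (_ | s) (_ | t) h <;> simp_all

/-- A deterministic strategy: the next message as a function of the strings received so far. -/
abbrev ReplyTable := List (List Bool) → Message

namespace ReplyTable

/-- The strategy that remains after the string `q` has been received. -/
def shift (q : List Bool) (f : ReplyTable) : ReplyTable := fun qs => f (q :: qs)

/-- The strategy that always sends `halt`. -/
def halting : ReplyTable := fun _ => .halt

/-- The messages that the strategy `b` receives when it moves first against `f`. -/
def received : ReplyTable → ReplyTable → ℕ → Option Message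
  | b, f, 0 =>
    match b [] with
    | .halt => none
    | .str q => some (f [q])
  | b, f, t + 1 =>
    match b [] with
    | .halt => none
    | .str q =>
      match f [q] with
      | .halt => none
      | .str a => received (b.shift a) (f.shift q) t

/-- `f` answers the queries of `p`, asked in order, by the replies of `p`, as far as the first
`halt`. -/
def Follows : List (List Bool × Message) → ReplyTable → Prop
  | [], _ => True
  | (q, m) :: p, f => f [q] = m ∧ (m = .halt ∨ Follows p (f.shift q))

/-- Two laws of strategies that agree on all events observable by asking queries in order. -/
def PathEquiv (μ ν : Measure ReplyTable) : Prop :=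
  ∀ p, μ {f | Follows p f} = ν {f | Follows p f}

/-! ### Measurability of interactions and of path events. -/

theorem measurable_shift (q : List Bool) : Measurable (shift q) :=
  measurable_pi_lambda _ fun qs => measurable_pi_apply (q :: qs)

theorem measurable_eval (qs : List (List Bool)) : Measurable fun f : ReplyTable => f qs :=
  measurable_pi_apply qs

/-- Lets a case distinction on a random message be treated one message at a time. -/
theorem measurable_of_countable_choice {α β γ : Type*} [MeasurableSpace α] [MeasurableSpace β]
    [MeasurableSpace γ] [Countable β] [DiscreteMeasurableSpace β] {e : α → β} (he : Measurable e)
    (G : β → α → γ) (hG : ∀ b, Measurable (G b)) : Measurable fun a => G (e a) a :=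
  (measurable_from_prod_countable_right (f := fun p : β × α => G p.1 p.2) hG).comp
    (he.prodMk measurable_id)

theorem measurable_received_apply (t : ℕ) :
    Measurable fun p : ReplyTable × ReplyTable => received p.1 p.2 t := by
  induction t with
  | zero =>
    simp only [received]
    refine measurable_of_countable_choice (e := fun p : ReplyTable × ReplyTable => p.1 [])
      ((measurable_pi_apply _).comp measurable_fst)
      (fun m p => match m with
        | .halt => none
        | .str q => some (p.2 [q])) ?_
    rintro (_ | q)
    · exact measurable_const
    · exact (measurable_of_countable some).comp ((measurable_pi_apply _).comp measurable_snd)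
  | succ t ih =>
    simp only [received]
    refine measurable_of_countable_choice (e := fun p : ReplyTable × ReplyTable => p.1 [])
      ((measurable_pi_apply _).comp measurable_fst)
      (fun m p => match m with
        | .halt => none
        | .str q =>
          match p.2 [q] with
          | .halt => none
          | .str a => received (p.1.shift a) (p.2.shift q) t) ?_
    rintro (_ | q)
    · exact measurable_const
    · refine measurable_of_countable_choice (e := fun p : ReplyTable × ReplyTable => p.2 [q])
        ((measurable_pi_apply _).comp measurable_snd)
        (fun m p => match m with
          | .halt => none
          | .str a => received (p.1.shift a) (p.2.shift q) t) ?_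
      rintro (_ | a)
      · exact measurable_const
      · exact ih.comp (((measurable_shift a).comp measurable_fst).prodMk
          ((measurable_shift q).comp measurable_snd))

theorem measurable_received :
    Measurable fun p : ReplyTable × ReplyTable => received p.1 p.2 :=
  measurable_pi_lambda _ measurable_received_apply

theorem measurable_received_right (b : ReplyTable) : Measurable (received b) :=
  measurable_received.comp (measurable_const.prodMk measurable_id)

theorem measurableSet_follows (p : List (List Bool × Message)) :
    MeasurableSet {f | Follows p f} := by
  induction p with
  | nil => simp [Follows]
  | cons x p ih =>
    obtain ⟨q, m⟩ := x
    simp only [Follows]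
    exact ((measurable_pi_apply [q]) (measurableSet_singleton m)).inter
      ((MeasurableSet.const _).union (measurable_shift q ih))

theorem received_halting (f : ReplyTable) : received halting f = fun _ => none := by
  funext t
  cases t <;> rfl

/-! ### Path events determine the law of what an adversary receives. -/

/-- A path never evaluates a strategy at `[]`. This matters because shifted and composed strategies
are identified only away from `[]`. -/
theorem follows_congr {p : List (List Bool × Message)} {f g : ReplyTable}
    (h : ∀ qs, qs ≠ [] → f qs = g qs) : Follows p f ↔ Follows p g := by
  induction p generalizing f g with
  | nil => rfl
  | cons x p ih =>
    have hs : Follows p (f.shift x.1) ↔ Follows p (g.shift x.1) :=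
      ih fun qs _ => h (x.1 :: qs) (by simp)
    simp only [Follows, h [x.1] (by simp), hs]

/-- An event about a strategy's first replies to an adversary is a path event or impossible. -/
theorem received_eq_iff_follows (n : ℕ) (b : ReplyTable) (w : ℕ → Option Message) :
    (∃ p, ∀ f, (∀ i < n, received b f i = w i) ↔ Follows p f) ∨
      ∀ f, ¬ ∀ i < n, received b f i = w i := by
  induction n generalizing b w with
  | zero => exact .inl ⟨[], by simp [Follows]⟩
  | succ n ih =>
    simp only [Nat.forall_lt_succ_left']
    cases hb : b [] with
    | halt =>
      simp only [received, hb]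
      by_cases h : none = w 0 ∧ ∀ i < n, none = w (i + 1)
      · exact .inl ⟨[], fun f => by simpa [Follows] using h⟩
      · exact .inr fun f => h
    | str q =>
      simp only [received, hb]
      rcases hw : w 0 with _ | (_ | a)
      · exact .inr fun f => by simp
      -- After `halt` nothing more is received, so the rest of `w` must be `none`.
      · by_cases h : ∀ i < n, none = w (i + 1)
        · refine .inl ⟨[(q, .halt)], fun f => ?_⟩
          simp only [Follows, Option.some.injEq, true_or, and_true]
          exact ⟨fun h => h.1, fun hf => ⟨hf, fun i hi => by simpa [hf] using h i hi⟩⟩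
        · refine .inr fun f hf => h fun i hi => ?_
          have h1 : f [q] = .halt := by simpa using hf.1
          simpa [h1] using hf.2 i hi
      · rcases ih (b.shift a) (fun i => w (i + 1)) with ⟨p, hp⟩ | hp
        · refine .inl ⟨(q, .str a) :: p, fun f => ?_⟩
          simp only [Follows, Option.some.injEq, reduceCtorEq, false_or, ← hp]
          exact and_congr_right fun h => by simp [h]
        · refine .inr fun f hf => hp (f.shift q) fun i hi => ?_
          have h1 : f [q] = .str a := by simpa using hf.1
          simpa [h1] using hf.2 i hi

/-- Prefix events are the atoms of the finite-dimensional marginals, and a projective limit of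
finite measures is unique. -/
theorem ext_of_prefix {β : Type} [MeasurableSpace β] [Countable β] [DiscreteMeasurableSpace β]
    {μ ν : Measure (ℕ → β)} [IsFiniteMeasure μ]
    (h : ∀ (n : ℕ) (w : ℕ → β), μ {v | ∀ i < n, v i = w i} = ν {v | ∀ i < n, v i = w i}) :
    μ = ν := by
  have hfin (n : ℕ) : μ.map (Preorder.frestrictLe n) = ν.map (Preorder.frestrictLe n) := by
    refine Measure.ext_of_singleton fun x => ?_
    have hm := Preorder.measurable_frestrictLe (X := fun _ : ℕ => β) n
    rw [Measure.map_apply hm (measurableSet_singleton x),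
      Measure.map_apply hm (measurableSet_singleton x)]
    -- The `min` only keeps the index within range; it equals `i` for every `i` considered.
    have hset : Preorder.frestrictLe (π := fun _ : ℕ => β) n ⁻¹' {x} =
        {v | ∀ i < n + 1, v i = x ⟨min i n, Finset.mem_Iic.2 (min_le_right _ _)⟩} := by
      ext v
      simp only [Set.mem_preimage, Set.mem_singleton_iff, funext_iff, Subtype.forall,
        Finset.mem_Iic, Set.mem_ofPred_eq, Nat.lt_succ_iff]
      refine forall₂_congr fun i hi => ?_
      simp [min_eq_left hi]
    rw [hset, h]
  let P : (I : Finset ℕ) → Measure (I → β) := fun I => μ.map I.restrict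
  have hP : IsProjectiveMeasureFamily (α := fun _ : ℕ => β) P := fun I J hJI => by
    rw [Measure.map_map (Finset.measurable_restrict₂ hJI) (Finset.measurable_restrict I)]
    rfl
  have hμ : IsProjectiveLimit (α := fun _ : ℕ => β) μ P := fun I => rfl
  have hν : IsProjectiveLimit (α := fun _ : ℕ => β) ν P := (isProjectiveLimit_nat_iff hP ν).2 fun n => (hfin n).symm
  have (I : Finset ℕ) : IsFiniteMeasure (P I) := inferInstanceAs (IsFiniteMeasure (μ.map I.restrict))
  exact hμ.unique hν

theorem PathEquiv.map_received_eq {μ ν : Measure ReplyTable} [IsProbabilityMeasure μ]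
    (h : PathEquiv μ ν) (b : ReplyTable) : μ.map (received b) = ν.map (received b) := by
  have hb := measurable_received_right b
  have := Measure.isProbabilityMeasure_map (μ := μ) hb.aemeasurable
  refine ext_of_prefix fun n w => ?_
  have hms : MeasurableSet {v : ℕ → Option Message | ∀ i < n, v i = w i} := by
    simp only [Set.ofPred_forall]
    exact .iInter fun i => .iInter fun _ =>
      measurableSet_eq_fun (measurable_pi_apply i) measurable_const
  rw [Measure.map_apply hb hms, Measure.map_apply hb hms]
  simp only [Set.preimage_ofPred_eq]
  rcases received_eq_iff_follows n b w with ⟨p, hp⟩ | hp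
  · simp only [hp]
    exact h p
  · simp [hp]

end ReplyTable

/-! ### The interaction in terms of deterministic strategies -/

namespace InteractiveMechanism

variable {X : Type*}

/-- The strategy of `M` on `x` with coins `r`. -/
def table (M : InteractiveMechanism X) (x : X) (r : M.Coins) : ReplyTable := fun qs => M.reply x qs r

theorem measurable_table (M : InteractiveMechanism X) (x : X) : Measurable (M.table x) :=
  measurable_pi_lambda _ fun qs => M.measurable_reply x qs

/-- The law of the strategy of `M` on `x`. -/
noncomputable def tableLaw (M : InteractiveMechanism X) (x : X) : Measure ReplyTable :=
  M.coinLaw.map (M.table x)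

instance (M : InteractiveMechanism X) (x : X) : IsProbabilityMeasure (M.tableLaw x) :=
  Measure.isProbabilityMeasure_map (M.measurable_table x).aemeasurable

end InteractiveMechanism

namespace Adversary

/-- The strategy of `B` with coins `r`. -/
def table (B : Adversary) (r : B.Coins) : ReplyTable := fun as => B.send as r

theorem measurable_table (B : Adversary) : Measurable B.table :=
  measurable_pi_lambda _ fun as => B.measurable_send as

/-- The adversary without coins that plays the strategy `b`. -/
noncomputable def ofTable (b : ReplyTable) : Adversary where
  Coins := Unit
  coinLaw := Measure.dirac ()
  send as _ := b as
  measurable_send _ := measurable_const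

end Adversary

namespace InteractiveMechanism

variable {X : Type*} (B : Adversary) (M : InteractiveMechanism X) (x : X) (rB : B.Coins)
  (rM : M.Coins)

theorem run_add_eq_none {t : ℕ} (h : run B M x rB rM t = none) (s : ℕ) :
    run B M x rB rM (t + s) = none := by
  induction s with
  | zero => exact h
  | succ s ih => rw [← add_assoc, run, ih]

/-- `run` accumulates a history, whereas `ReplyTable.received` recurses on strategies shifted past
the first exchange. Stating the comparison from an arbitrary history makes the induction close. -/
theorem received_add_of_run_eq {t : ℕ} {qs as : List (List Bool)}
    (h : run B M x rB rM t = some (qs, as)) (s : ℕ) :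
    received B M x rB rM (t + s) = ReplyTable.received (fun l => B.table rB (as ++ l))
      (fun l => M.table x rM (qs ++ l)) s := by
  induction s generalizing t qs as with
  | zero =>
    simp only [received, add_zero, h, ReplyTable.received, Adversary.table, table, List.append_nil]
  | succ s ih =>
    have hrun : run B M x rB rM (t + 1) = match B.send as rB with
      | .halt => none
      | .str q =>
        match M.reply x (qs ++ [q]) rM with
        | .halt => none
        | .str a => some (qs ++ [q], as ++ [a]) := by
      rw [run, h]
    rw [add_comm s 1, ← add_assoc, add_comm 1 s]
    simp only [ReplyTable.received, Adversary.table, table, List.append_nil]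
    cases hq : B.send as rB with
    | halt =>
      simp only [hq] at hrun
      simp [received, run_add_eq_none B M x rB rM hrun s]
    | str q =>
      simp only [hq] at hrun
      cases ha : M.reply x (qs ++ [q]) rM with
      | halt =>
        simp only [ha] at hrun
        simp [received, ha, run_add_eq_none B M x rB rM hrun s]
      | str a =>
        simp only [ha] at hrun
        rw [ih hrun]
        simp only [List.append_assoc, List.singleton_append, ha]
        rfl

theorem received_eq : received B M x rB rM =
    ReplyTable.received (B.table rB) (M.table x rM) := by
  funext t
  have := received_add_of_run_eq B M x rB rM (t := 0) rfl t
  rw [zero_add] at this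
  rw [this]
  rfl

theorem measurable_received :
    Measurable fun r : B.Coins × M.Coins => received B M x r.1 r.2 := by
  simp only [received_eq]
  exact ReplyTable.measurable_received.comp
    ((B.measurable_table.comp measurable_fst).prodMk ((M.measurable_table x).comp measurable_snd))

theorem map_snd_view_ofTable (b : ReplyTable) :
    (view (.ofTable b) M x).map Prod.snd = (M.tableLaw x).map (ReplyTable.received b) := by
  have hm := measurable_received (.ofTable b) M x
  rw [view, Measure.map_map measurable_snd (measurable_fst.prodMk hm), tableLaw,
    Measure.map_map (ReplyTable.measurable_received_right b) (M.measurable_table x)]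
  have : (Prod.snd ∘ fun r : (Adversary.ofTable b).Coins × M.Coins =>
      (r.1, received (.ofTable b) M x r.1 r.2)) =
      (ReplyTable.received b ∘ M.table x) ∘ Prod.snd := by
    funext r
    simp only [Function.comp, received_eq]
    rfl
  rw [this, ← Measure.map_map ((ReplyTable.measurable_received_right b).comp
    (M.measurable_table x)) measurable_snd]
  congr 1
  exact (Measure.snd_prod (μ := (Adversary.ofTable b).coinLaw) (ν := M.coinLaw))

/-- The joint law of the coins of `B` and the view, given the coins of `B`. -/
noncomputable def viewKernel : Kernel B.Coins (B.Coins × (ℕ → Option Message)) :=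
  (Kernel.id ×ₖ Kernel.const B.Coins M.coinLaw).map fun r => (r.1, received B M x r.1 r.2)

instance : IsMarkovKernel (viewKernel B M x) :=
  Kernel.IsMarkovKernel.map _ (measurable_fst.prodMk (measurable_received B M x))

theorem bind_viewKernel : B.coinLaw.bind (viewKernel B M x) = view B M x := by
  rw [viewKernel, view, ← Measure.map_comp _ _ (measurable_fst.prodMk (measurable_received B M x))]
  rw [← Measure.compProd_eq_comp_prod, Measure.compProd_const]

theorem viewKernel_apply : viewKernel B M x rB =
    ((M.tableLaw x).map (ReplyTable.received (B.table rB))).map (Prod.mk rB) := by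
  rw [viewKernel, Kernel.map_apply _ (measurable_fst.prodMk (measurable_received B M x)),
    Kernel.prod_apply, Kernel.id_apply, Kernel.const_apply, Measure.dirac_prod,
    Measure.map_map (measurable_fst.prodMk (measurable_received B M x)) measurable_prodMk_left,
    tableLaw, Measure.map_map (ReplyTable.measurable_received_right _) (M.measurable_table x),
    Measure.map_map measurable_prodMk_left
      ((ReplyTable.measurable_received_right _).comp (M.measurable_table x))]
  congr 1
  funext r
  simp [received_eq]

end InteractiveMechanism

/-! ### Concurrent composition of strategies -/

namespace ReplyTable

open InteractiveMechanism

variable {k : ℕ} (parse : List Bool → Option (Fin k × List Bool))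

/-- The concurrent composition of deterministic strategies. -/
def conc (f : Fin k → ReplyTable) : ReplyTable := fun ms =>
  match ms.getLast?.bind parse with
  | none => .halt
  | some (j, _) => f j (queriesTo parse j ms)

theorem measurable_conc : Measurable (conc parse) := by
  refine measurable_pi_lambda _ fun ms => ?_
  unfold conc
  cases h : ms.getLast?.bind parse with
  | none => exact measurable_const
  | some p => exact (measurable_pi_apply _).comp (measurable_pi_apply p.1)

theorem conc_singleton {s : List Bool} {j : Fin k} {q : List Bool} (h : parse s = some (j, q))
    (f : Fin k → ReplyTable) : conc parse f [s] = f j [q] := by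
  simp [conc, queriesTo, h]

/-- A message addressed to `j` advances only the strategy of `j`. At `[]` this fails, since the
right side then halts. -/
theorem conc_cons {s : List Bool} {j : Fin k} {q : List Bool} (h : parse s = some (j, q))
    (f : Fin k → ReplyTable) {ms : List (List Bool)} (hms : ms ≠ []) :
    (conc parse f).shift s ms = conc parse (Function.update f j ((f j).shift q)) ms := by
  obtain ⟨l, a, rfl⟩ := List.eq_nil_or_concat ms |>.resolve_left hms
  have h1 : (s :: (l ++ [a])).getLast? = some a := by
    rw [← List.cons_append, List.getLast?_append]; simp
  simp only [conc, shift, List.concat_eq_append, h1, List.getLast?_append, List.getLast?_singleton,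
    Option.some_or, Option.bind_some]
  cases parse a with
  | none => rfl
  | some p =>
    obtain ⟨i, q'⟩ := p
    by_cases hij : i = j
    · subst hij
      simp [queriesTo, h, shift]
    · simp [queriesTo, h, hij, Ne.symm hij]

/-- An interleaved path splits into one path per component, so it is a product event. The exception
is a path that demands a string in reply to an unparsable message. -/
theorem conc_follows (p : List (List Bool × Message)) :
    (∃ P : Fin k → List (List Bool × Message),
      ∀ f, Follows p (conc parse f) ↔ ∀ j, Follows (P j) (f j)) ∨
      ∀ f, ¬ Follows p (conc parse f) := by
  induction p with
  | nil => exact .inl ⟨fun _ => [], by simp [Follows]⟩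
  | cons x p ih =>
    obtain ⟨s, m⟩ := x
    simp only [Follows]
    cases hs : parse s with
    | none =>
      have h (f) : conc parse f [s] = .halt := by simp [conc, hs]
      simp only [h]
      by_cases hm : m = .halt
      · exact .inl ⟨fun _ => [], by simp [Follows, hm]⟩
      · exact .inr fun f hf => hm hf.1.symm
    | some y =>
      obtain ⟨j, q⟩ := y
      have hp (f) : Follows p ((conc parse f).shift s) ↔
          Follows p (conc parse (Function.update f j ((f j).shift q))) :=
        follows_congr fun ms hms => conc_cons parse hs f hms
      simp only [conc_singleton parse hs, hp]
      cases m with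
      | halt =>
        refine .inl ⟨Function.update (fun _ => []) j [(q, .halt)], fun f => ?_⟩
        simp only [true_or, and_true]
        refine ⟨fun hf i => ?_, fun hf => ?_⟩
        · by_cases hij : i = j
          · subst hij; simp [Follows, hf]
          · simp [hij, Follows]
        · simpa [Follows] using hf j
      | str a =>
        rcases ih with ⟨P, hP⟩ | hP
        · refine .inl ⟨Function.update P j ((q, .str a) :: P j), fun f => ?_⟩
          simp only [hP, reduceCtorEq, false_or]
          refine ⟨fun hf i => ?_, fun hf => ⟨?_, fun i => ?_⟩⟩
          · by_cases hij : i = j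
            · subst hij
              simpa [Follows, hf.1] using hf.2 i
            · simpa [hij] using hf.2 i
          · have := hf j
            simp only [Function.update_self, Follows] at this
            exact this.1
          · by_cases hij : i = j
            · subst hij
              have := hf i
              simp only [Function.update_self, Follows, reduceCtorEq, false_or] at this
              simpa using this.2
            · simpa [hij] using hf i
        · exact .inr fun f hf => hP _ (hf.2.resolve_left (by simp))

theorem PathEquiv.conc {μ ν : Fin k → Measure ReplyTable} [∀ j, IsProbabilityMeasure (μ j)]
    [∀ j, IsProbabilityMeasure (ν j)] (h : ∀ j, PathEquiv (μ j) (ν j)) :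
    PathEquiv ((Measure.pi μ).map (conc parse)) ((Measure.pi ν).map (conc parse)) := by
  intro p
  rw [Measure.map_apply (measurable_conc parse) (measurableSet_follows p),
    Measure.map_apply (measurable_conc parse) (measurableSet_follows p), Set.preimage_ofPred_eq]
  rcases conc_follows parse p with ⟨P, hP⟩ | hP
  · have : {f : Fin k → ReplyTable | Follows p (ReplyTable.conc parse f)} =
        Set.univ.pi fun j => {f | Follows (P j) f} := by
      ext f; simp [hP]
    rw [this, Measure.pi_pi, Measure.pi_pi]
    exact Finset.prod_congr rfl fun j _ => h j (P j)
  · simp [hP]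

end ReplyTable

theorem InteractiveMechanism.tableLaw_conComp {k : ℕ} {X : Fin k → Type*}
    (parse : List Bool → Option (Fin k × List Bool)) (M : ∀ j, InteractiveMechanism (X j))
    (x : ∀ j, X j) : (conComp parse M).tableLaw x =
      (Measure.pi fun j => (M j).tableLaw (x j)).map (ReplyTable.conc parse) := by
  have h1 : (Measure.pi fun j => (M j).tableLaw (x j)) =
      (Measure.pi fun j => (M j).coinLaw).map fun r j => (M j).table (x j) (r j) :=
    (Measure.pi_map_pi fun j => ((M j).measurable_table (x j)).aemeasurable).symm
  have h2 : Measurable fun (r : ∀ j, (M j).Coins) j => (M j).table (x j) (r j) :=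
    measurable_pi_lambda _ fun j => ((M j).measurable_table (x j)).comp (measurable_pi_apply j)
  rw [h1, Measure.map_map (ReplyTable.measurable_conc parse) h2]
  rfl

/-! ### Suprema, conditional laws and couplings of finite families -/

/-- A bound on a function on a product of sets extends to all points below the suprema of these
sets, if the function is continuous in each of its finitely many variables. -/
theorem SupContinuousInEach.le_of_forall_mem {ι A B : Type*} [PartialOrder A] [PartialOrder B]
    [Finite ι] {f : (ι → A) → B} (hf : SupContinuousInEach f) {S : ι → Set A}
    (hS : ∀ i, (S i).Nonempty) {s : ι → A} (hs : ∀ i, IsLUB (S i) (s i)) {b : B}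
    (h : ∀ x, (∀ i, x i ∈ S i) → f x ≤ b) {y : ι → A} (hy : ∀ i, y i ≤ s i) : f y ≤ b := by
  classical
  have := Fintype.ofFinite ι
  -- The coordinates in `J` have already been relaxed from membership in `S i` to being below `s i`.
  suffices H : ∀ J : Finset ι, ∀ x : ι → A, (∀ i ∉ J, x i ∈ S i) → (∀ i ∈ J, x i ≤ s i) →
      f x ≤ b from H Finset.univ y (by simp) fun i _ => hy i
  intro J
  induction J using Finset.induction_on with
  | empty => exact fun x hx _ => h x fun i => hx i (by simp)
  | insert j J hj ih =>
    intro x hx hx'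
    have hcont : ∀ S : Set A, S.Nonempty → ∀ s, IsLUB S s →
        IsLUB ((fun y => f (Function.update x j y)) '' S) (f (Function.update x j s)) := by
      intro S hS s hs
      have := hf j x S hS s hs
      convert this
    have h1 : f (Function.update x j (s j)) ≤ b := by
      refine (hcont (S j) (hS j) (s j) (hs j)).2 ?_
      rintro _ ⟨z, hz, rfl⟩
      refine ih _ (fun i hi => ?_) fun i hi => ?_
      · by_cases hij : i = j
        · subst hij; simpa using hz
        · simpa [hij] using hx i (by simp [hij, hi])
      · have hij : i ≠ j := fun h => hj (h ▸ hi)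
        simpa [hij] using hx' i (by simp [hi])
    -- Continuity yields monotonicity: `s j` is the supremum of the pair `{x j, s j}`.
    have h2 : IsLUB {x j, s j} (s j) := by
      have := hx' j (by simp)
      exact ⟨by simp [upperBounds, this], fun u hu => hu (by simp)⟩
    refine le_trans ?_ h1
    exact (hcont _ ⟨_, Set.mem_insert _ _⟩ _ h2).1 ⟨x j, by simp, by simp⟩

section condLaw

variable {Ω α β : Type} [MeasurableSpace Ω] [MeasurableSpace α] [MeasurableSpace β]
  [MeasurableSingletonClass α]

theorem condLaw_map_prodMk (μ : Measure Ω) {e : Ω → α} (he : Measurable e) {h : α → Ω → β}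
    (hh : Measurable fun ω => h (e ω) ω) (x : α) :
    condLaw (μ.map fun ω => (e ω, h (e ω) ω)) x = (μ[|e ⁻¹' {x}]).map (h x) := by
  have hm := he.prodMk hh
  have hx' : MeasurableSet (Prod.fst ⁻¹' {x} : Set (α × β)) :=
    measurable_fst (measurableSet_singleton x)
  rw [condLaw, ProbabilityTheory.cond, ProbabilityTheory.cond, Measure.map_smul, Measure.map_smul,
    Measure.restrict_map hm hx', Measure.map_map measurable_snd hm, Measure.map_apply hm hx']
  congr 1
  refine Measure.map_congr ?_
  refine (ae_restrict_iff' (hm hx')).2 (.of_forall fun ω hω => ?_)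
  have : e ω = x := hω
  simp [this]

theorem condLaw_compProd (ν : Measure α) [IsProbabilityMeasure ν] (κ : Kernel α β)
    [IsMarkovKernel κ] {x : α} (hx : ν {x} ≠ 0) : condLaw (ν ⊗ₘ κ) x = κ x := by
  ext s hs
  have hset : Prod.fst ⁻¹' {x} = ({x} : Set α) ×ˢ (Set.univ : Set β) := by ext; simp
  have hset' : Prod.fst ⁻¹' {x} ∩ Prod.snd ⁻¹' s = ({x} : Set α) ×ˢ s := by ext; simp
  have hx' : MeasurableSet (Prod.fst ⁻¹' {x} : Set (α × β)) :=
    measurable_fst (measurableSet_singleton x)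
  rw [condLaw, Measure.map_apply measurable_snd hs, cond_apply hx', hset', hset,
    Measure.compProd_apply_prod (measurableSet_singleton x) hs,
    Measure.compProd_apply_prod (measurableSet_singleton x) .univ]
  simp only [lintegral_singleton, measure_univ, one_mul]
  rw [mul_comm (κ x s), ← mul_assoc, ENNReal.inv_mul_cancel hx (measure_ne_top _ _), one_mul]

end condLaw

namespace GeneralizedDistance

variable {𝒟 : Type*} [PartialOrder 𝒟] {D : GeneralizedDistance 𝒟}

/-- Constant random variables are at least as close as any two random variables. -/
theorem dist_dirac_le {α β : Type} [MeasurableSpace α] [MeasurableSpace β] {μ ν : Measure α}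
    [IsProbabilityMeasure μ] [IsProbabilityMeasure ν] {d : 𝒟} (h : D.dist μ ν ≤ d) (y : β) :
    D.dist (Measure.dirac y) (Measure.dirac y) ≤ d := by
  have := D.post_processing μ ν (fun _ => y) measurable_const
  simp only [Measure.map_const, measure_univ, one_smul] at this
  exact this.trans h

/-- The coupling property for finite families. -/
theorem CouplingProperty.finset (hD : D.CouplingProperty) {ι α : Type} [Countable ι]
    [MeasurableSpace α] [StandardBorelSpace α] {d : 𝒟}
    (hd : ∃ y : α, D.dist (Measure.dirac y) (Measure.dirac y) ≤ d) (ρ ρ' : ι → Measure α)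
    [∀ i, IsProbabilityMeasure (ρ i)] [∀ i, IsProbabilityMeasure (ρ' i)] (J : Finset ι)
    (h : ∀ i ∈ J, D.dist (ρ i) (ρ' i) ≤ d) :
    ∃ τ τ' : Measure (ι → α), IsProbabilityMeasure τ ∧ IsProbabilityMeasure τ' ∧
      D.dist τ τ' ≤ d ∧ ∀ i ∈ J, τ.map (fun g => g i) = ρ i ∧ τ'.map (fun g => g i) = ρ' i := by
  classical
  induction J using Finset.induction_on with
  | empty =>
    obtain ⟨y, hy⟩ := hd
    exact ⟨Measure.dirac fun _ => y, Measure.dirac fun _ => y, inferInstance, inferInstance,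
      dist_dirac_le hy _, by simp⟩
  | insert j J hj ih =>
    obtain ⟨τ, τ', hτ, hτ', hle, hmap⟩ := ih fun i hi => h i (by simp [hi])
    obtain ⟨σ, σ', hσ, hσ', h1, h2, h1', h2', hle'⟩ :=
      hD d (ι → α) α τ τ' (ρ j) (ρ' j) hle (h j (by simp))
    -- Overwriting coordinate `j` by the newly coupled variable leaves the marginals at the other
    -- coordinates intact.
    let u : (ι → α) × α → ι → α := fun p => Function.update p.1 j p.2
    have hu : Measurable u := measurable_pi_lambda _ fun i => by
      by_cases hij : i = j
      · subst hij; simpa [u] using measurable_snd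
      · simpa [u, hij, Function.comp_def] using (measurable_pi_apply i).comp measurable_fst
    have hu1 : (fun g : ι → α => g j) ∘ u = Prod.snd := by ext p; simp [u]
    have hu2 (i : ι) (hij : i ≠ j) :
        (fun g : ι → α => g i) ∘ u = (fun g : ι → α => g i) ∘ Prod.fst := by ext p; simp [u, hij]
    refine ⟨σ.map u, σ'.map u, Measure.isProbabilityMeasure_map hu.aemeasurable,
      Measure.isProbabilityMeasure_map hu.aemeasurable, (D.post_processing σ σ' u hu).trans hle',
      fun i hi => ?_⟩
    rw [Measure.map_map (measurable_pi_apply i) hu, Measure.map_map (measurable_pi_apply i) hu]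
    by_cases hij : i = j
    · subst hij
      rw [hu1]
      exact ⟨h2, h2'⟩
    · rw [hu2 i hij, ← Measure.map_map (measurable_pi_apply i) measurable_fst,
        ← Measure.map_map (measurable_pi_apply i) measurable_fst, h1, h1']
      exact hmap i ((Finset.mem_insert.1 hi).resolve_left hij)

end GeneralizedDistance

/-! ### Private strategies as post-processings of private tables -/

namespace ReplyTable

variable {𝒟 : Type*} [PartialOrder 𝒟] {D : GeneralizedDistance 𝒟}

/-- The views of all deterministic adversaries are `d`-close. -/
def IsClose (D : GeneralizedDistance 𝒟) (d : 𝒟) (μ ν : Measure ReplyTable) : Prop :=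
  ∀ b, D.dist (μ.map (received b)) (ν.map (received b)) ≤ d

/-- `f` replies `halt` to more than `n` queries and to queries of more than `c` bits, and its
replies have at most `c` bits. -/
def IsBounded (n c : ℕ) (f : ReplyTable) : Prop :=
  ∀ qs, qs ≠ [] → ((n < qs.length ∨ ∃ q ∈ qs, c < q.length) → f qs = .halt) ∧
    (f qs).bitLength ≤ c

theorem IsBounded.shift {n c : ℕ} {f : ReplyTable} (h : IsBounded (n + 1) c f) (q : List Bool) :
    IsBounded n c (f.shift q) := fun qs _ => by
  have := h (q :: qs) (by simp)
  refine ⟨fun hqs => this.1 ?_, this.2⟩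
  rcases hqs with hn | ⟨q', hq', hc⟩
  · exact .inl (by simpa using hn)
  · exact .inr ⟨q', by simp [hq'], hc⟩

theorem measurableSet_isBounded (n c : ℕ) : MeasurableSet {f | IsBounded n c f} := by
  have : {f | IsBounded n c f} = ⋂ qs : List (List Bool), (fun f : ReplyTable => f qs) ⁻¹'
      {m | qs ≠ [] → ((n < qs.length ∨ ∃ q ∈ qs, c < q.length) → m = .halt) ∧
        m.bitLength ≤ c} := by
    ext f; simp [IsBounded]
  rw [this]
  exact .iInter fun qs => measurable_pi_apply qs (.of_discrete)

theorem finite_bitLength_le (c : ℕ) : {m : Message | m.bitLength ≤ c}.Finite := by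
  refine (((List.finite_length_le Bool c).image Message.str).insert .halt).subset ?_
  rintro (_ | s) h
  · simp
  · exact .inr ⟨s, h, rfl⟩

/-! ### Conditioning on the first reply. -/

/-- The law of the remaining strategy after the reply `m` to the query `q`. -/
noncomputable def condShift (q : List Bool) (m : Message) (μ : Measure ReplyTable) :
    Measure ReplyTable :=
  (μ[|(fun f : ReplyTable => f [q]) ⁻¹' {m}]).map (shift q)

section condShift

variable {q : List Bool} {m : Message} {μ ν : Measure ReplyTable}

theorem isProbabilityMeasure_condShift [IsProbabilityMeasure μ]
    (h : μ.map (fun f => f [q]) {m} ≠ 0) :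
    IsProbabilityMeasure (condShift q m μ) := by
  rw [Measure.map_apply (measurable_eval [q]) (measurableSet_singleton m)] at h
  have := cond_isProbabilityMeasure h
  exact Measure.isProbabilityMeasure_map (measurable_shift q).aemeasurable

theorem ae_isBounded_condShift {n c : ℕ} (h : ∀ᵐ f ∂μ, IsBounded (n + 1) c f) :
    ∀ᵐ f ∂condShift q m μ, IsBounded n c f := by
  rw [condShift, ae_map_iff (measurable_shift q).aemeasurable (measurableSet_isBounded n c)]
  filter_upwards [cond_absolutelyContinuous.ae_le h] with f hf using hf.shift q

open Classical in
-- The multiplication rule for conditional probabilities; after `halt` the rest of a path imposes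
-- nothing.
theorem follows_cons_eq [IsProbabilityMeasure μ] (p : List (List Bool × Message)) :
    μ {f | Follows ((q, m) :: p) f} = μ.map (fun f => f [q]) {m} *
      if m = .halt then 1 else condShift q m μ {f | Follows p f} := by
  have hm := measurable_eval [q]
  rw [Measure.map_apply hm (measurableSet_singleton m)]
  have hset : {f : ReplyTable | Follows ((q, m) :: p) f} =
      (fun f : ReplyTable => f [q]) ⁻¹' {m} ∩ {f | m = .halt ∨ Follows p (f.shift q)} := by
    ext f; simp [Follows]
  rw [hset]
  split_ifs with h
  · simp [h]
  · rw [condShift, Measure.map_apply (measurable_shift q) (measurableSet_follows p), mul_comm,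
      cond_mul_eq_inter (hm (measurableSet_singleton m))]
    simp [h]

/-- The strategy that asks `q` first and then plays `b m` against the reply `m`. -/
def queryThen (q : List Bool) (b : Message → ReplyTable) : ReplyTable
  | [] => .str q
  | a :: as => b (.str a) as

/-- The pair is read off from what the single adversary `queryThen q b` receives. As a reply `halt`
ends the interaction, the continuation after it must be silent, whence `hb`. -/
theorem IsClose.dist_map_prodMk_le [IsProbabilityMeasure μ] [IsProbabilityMeasure ν] {d : 𝒟} (h : IsClose D d μ ν) (q : List Bool)
    (b : Message → ReplyTable) (hb : b .halt = halting) :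
    D.dist (μ.map fun f => (f [q], received (b (f [q])) (f.shift q)))
      (ν.map fun f => (f [q], received (b (f [q])) (f.shift q))) ≤ d := by
  let g : (ℕ → Option Message) → Message × (ℕ → Option Message) :=
    fun v => ((v 0).getD .halt, fun t => v (t + 1))
  have hg : Measurable g :=
    ((measurable_of_countable fun o : Option Message => o.getD .halt).comp
      (measurable_pi_apply 0)).prodMk (measurable_pi_lambda _ fun t => measurable_pi_apply (t + 1))
  have hr := measurable_received_right (queryThen q b)
  have hgr : (fun f : ReplyTable => (f [q], received (b (f [q])) (f.shift q))) =
      g ∘ received (queryThen q b) := by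
    funext f
    refine Prod.ext ?_ (funext fun t => ?_)
    · simp [g, received, queryThen]
    · simp only [g, Function.comp, received, queryThen]
      cases hf : f [q] with
      | halt => simp [hb, received_halting]
      | str a => rfl
  have h1 := Measure.isProbabilityMeasure_map (μ := μ) hr.aemeasurable
  have h2 := Measure.isProbabilityMeasure_map (μ := ν) hr.aemeasurable
  rw [hgr, ← Measure.map_map hg hr, ← Measure.map_map hg hr]
  exact (D.post_processing _ _ g hg).trans (h _)

theorem condLaw_map_received (μ : Measure ReplyTable) (q : List Bool) (b : Message → ReplyTable)
    (m : Message) : condLaw (μ.map fun f => (f [q], received (b (f [q])) (f.shift q))) m =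
      (condShift q m μ).map (received (b m)) := by
  have hm := measurable_eval [q]
  rw [condShift, Measure.map_map (measurable_received_right _) (measurable_shift q)]
  exact condLaw_map_prodMk μ hm (h := fun m f => received (b m) (f.shift q))
    (measurable_received.comp (((measurable_of_countable b).comp hm).prodMk (measurable_shift q))) m

end condShift

/-- If the reply to `q` has finitely many values and the strategies that remain after it can be
replaced by tables at the same distance, so can the reply together with the rest. -/
theorem exists_reply_and_table (hcomplete : IsCompletePoset 𝒟) (hchain : D.ChainRule) {d : 𝒟}
    {μ ν : Measure ReplyTable} [IsProbabilityMeasure μ] [IsProbabilityMeasure ν]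
    (h : IsClose D d μ ν) (q : List Bool)
    (hfin : ∃ F : Set Message, F.Finite ∧ μ.map (fun f => f [q]) Fᶜ = 0 ∧
      ν.map (fun f => f [q]) Fᶜ = 0)
    (ih : ∀ m, ∀ e : 𝒟, μ.map (fun f => f [q]) {m} ≠ 0 → ν.map (fun f => f [q]) {m} ≠ 0 →
      IsClose D e (condShift q m μ) (condShift q m ν) →
      ∃ τ τ' : Measure ReplyTable, IsProbabilityMeasure τ ∧ IsProbabilityMeasure τ' ∧
        D.dist τ τ' ≤ e ∧ PathEquiv τ (condShift q m μ) ∧ PathEquiv τ' (condShift q m ν)) :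
    ∃ ρ ρ' : Measure (Message × ReplyTable), IsProbabilityMeasure ρ ∧ IsProbabilityMeasure ρ' ∧
      D.dist ρ ρ' ≤ d ∧ ∀ m p,
        ρ {y | y.1 = m ∧ (m = .halt ∨ Follows p y.2)} = μ {f | Follows ((q, m) :: p) f} ∧
        ρ' {y | y.1 = m ∧ (m = .halt ∨ Follows p y.2)} = ν {f | Follows ((q, m) :: p) f} := by
  have he := measurable_eval [q]
  set μ₁ := μ.map fun f => f [q]
  set ν₁ := ν.map fun f => f [q]
  have : IsProbabilityMeasure μ₁ := Measure.isProbabilityMeasure_map he.aemeasurable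
  have : IsProbabilityMeasure ν₁ := Measure.isProbabilityMeasure_map he.aemeasurable
  obtain ⟨C, hC, hCdist⟩ := hchain Message μ₁ ν₁ hfin
  have : Finite {m : Message // μ₁ {m} ≠ 0 ∧ ν₁ {m} ≠ 0} := by
    obtain ⟨F, hF, hμF, -⟩ := hfin
    refine (hF.subset fun m hm => ?_).to_subtype
    by_contra hmF
    exact hm.1 (measure_mono_null (by simpa using hmF) hμF)
  -- The distances that continuations can achieve after reply `m`; after `halt` the only
  -- continuation is silence.
  let S : {m : Message // μ₁ {m} ≠ 0 ∧ ν₁ {m} ≠ 0} → Set 𝒟 := fun m =>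
    {e | ∃ b : ReplyTable, (m.1 = .halt → b = halting) ∧
      e = D.dist ((condShift q m.1 μ).map (received b)) ((condShift q m.1 ν).map (received b))}
  have hS (m) : (S m).Nonempty := ⟨_, halting, fun _ => rfl, rfl⟩
  choose s hs using fun m => hcomplete (S m) (hS m)
  have hCS : ∀ e, (∀ m, e m ∈ S m) → C e ≤ d := by
    intro e hmem
    choose b hb heq using hmem
    classical
    -- One adversary realizes all chosen continuations at once. Replies outside the common support
    -- do not enter `C`, so any continuation serves there.
    let b' : Message → ReplyTable := fun m => if hm : _ then b ⟨m, hm⟩ else halting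
    have hb' : b' .halt = halting := by
      simp only [b']
      split_ifs with hm
      · exact hb ⟨_, hm⟩ rfl
      · rfl
    have hrm : Measurable fun f : ReplyTable => (f [q], received (b' (f [q])) (f.shift q)) :=
      he.prodMk (measurable_received.comp
        (((measurable_of_countable b').comp he).prodMk (measurable_shift q)))
    have h1 := Measure.isProbabilityMeasure_map (μ := μ) hrm.aemeasurable
    have h2 := Measure.isProbabilityMeasure_map (μ := ν) hrm.aemeasurable
    have hle := h.dist_map_prodMk_le q b' hb'
    rw [hCdist _ _ _ (Measure.map_map measurable_fst hrm) (Measure.map_map measurable_fst hrm)]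
      at hle
    simp only [condLaw_map_received] at hle
    convert hle using 2 with
    funext m
    simp only [b', dif_pos m.2, heq m]
  have hτ : ∀ m, ∃ τ τ' : Measure ReplyTable, IsProbabilityMeasure τ ∧ IsProbabilityMeasure τ' ∧
      (∀ hm : μ₁ {m} ≠ 0 ∧ ν₁ {m} ≠ 0, D.dist τ τ' ≤ s ⟨m, hm⟩) ∧
      (μ₁ {m} ≠ 0 → m ≠ .halt → PathEquiv τ (condShift q m μ)) ∧
      (ν₁ {m} ≠ 0 → m ≠ .halt → PathEquiv τ' (condShift q m ν)) := by
    intro m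
    by_cases hm : μ₁ {m} ≠ 0 ∧ ν₁ {m} ≠ 0
    · have := isProbabilityMeasure_condShift hm.1
      have := isProbabilityMeasure_condShift hm.2
      by_cases hmh : m = .halt
      -- After `halt` no table is ever consulted, so a constant one suffices.
      · have hle := (hs ⟨m, hm⟩).1 ⟨halting, fun _ => rfl, rfl⟩
        have := Measure.isProbabilityMeasure_map (μ := condShift q m μ)
          (measurable_received_right halting).aemeasurable
        have := Measure.isProbabilityMeasure_map (μ := condShift q m ν)
          (measurable_received_right halting).aemeasurable
        exact ⟨Measure.dirac halting, Measure.dirac halting, inferInstance, inferInstance,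
          fun _ => GeneralizedDistance.dist_dirac_le hle halting, fun _ h => absurd hmh h,
          fun _ h => absurd hmh h⟩
      · obtain ⟨τ, τ', h1, h2, hle, hp, hp'⟩ := ih m (s ⟨m, hm⟩) hm.1 hm.2 fun b =>
          (hs ⟨m, hm⟩).1 ⟨b, fun h => absurd h hmh, rfl⟩
        exact ⟨τ, τ', h1, h2, fun _ => hle, fun _ _ => hp, fun _ _ => hp'⟩
    -- Off the common support no closeness is needed: the conditional law itself serves, or any law
    -- if the reply has probability zero.
    · have aux (η : Measure ReplyTable) [IsProbabilityMeasure η] : ∃ τ : Measure ReplyTable,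
          IsProbabilityMeasure τ ∧ (η.map (fun f => f [q]) {m} ≠ 0 →
            PathEquiv τ (condShift q m η)) := by
        by_cases h : η.map (fun f => f [q]) {m} = 0
        · exact ⟨Measure.dirac halting, inferInstance, fun h' => absurd h h'⟩
        · exact ⟨_, isProbabilityMeasure_condShift h, fun _ _ => rfl⟩
      obtain ⟨τ, h1, hp⟩ := aux μ
      obtain ⟨τ', h2, hp'⟩ := aux ν
      exact ⟨τ, τ', h1, h2, fun h => absurd h hm, fun h _ => hp h, fun h _ => hp' h⟩
  choose τ τ' hτ1 hτ2 hle hp hp' using hτ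
  let κ : Kernel Message ReplyTable := ⟨τ, measurable_of_countable τ⟩
  let κ' : Kernel Message ReplyTable := ⟨τ', measurable_of_countable τ'⟩
  have : IsMarkovKernel κ := ⟨hτ1⟩
  have : IsMarkovKernel κ' := ⟨hτ2⟩
  refine ⟨μ₁ ⊗ₘ κ, ν₁ ⊗ₘ κ', inferInstance, inferInstance, ?_, ?_⟩
  · rw [hCdist _ _ _ (Measure.fst_compProd _ _) (Measure.fst_compProd _ _)]
    -- Continuity passes from individual continuations to their suprema `s`, and then down to the
    -- tables' distances.
    refine hC.le_of_forall_mem hS hs hCS fun m => ?_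
    rw [condLaw_compProd _ _ m.2.1, condLaw_compProd _ _ m.2.2]
    exact hle m.1 m.2
  · have aux (η : Measure ReplyTable) [IsProbabilityMeasure η] (κ : Kernel Message ReplyTable)
        [IsMarkovKernel κ]
        (hκ : ∀ m, η.map (fun f => f [q]) {m} ≠ 0 → m ≠ .halt → PathEquiv (κ m) (condShift q m η))
        (m : Message) (p : List (List Bool × Message)) :
        (η.map (fun f => f [q]) ⊗ₘ κ) {y | y.1 = m ∧ (m = .halt ∨ Follows p y.2)} =
          η {f | Follows ((q, m) :: p) f} := by
      have : IsProbabilityMeasure (η.map fun f => f [q]) :=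
        Measure.isProbabilityMeasure_map he.aemeasurable
      have hset : {y : Message × ReplyTable | y.1 = m ∧ (m = .halt ∨ Follows p y.2)} =
          {m} ×ˢ {f | m = .halt ∨ Follows p f} := by
        ext y; simp
      have hms : MeasurableSet {f | m = .halt ∨ Follows p f} :=
        (MeasurableSet.const _).union (measurableSet_follows p)
      rw [hset, Measure.compProd_apply_prod (measurableSet_singleton m) hms, lintegral_singleton,
        follows_cons_eq, mul_comm]
      by_cases h0 : η.map (fun f => f [q]) {m} = 0
      · rw [h0, zero_mul, zero_mul]
      · congr 1
        split_ifs with h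
        · simp [h]
        · simpa [h] using hκ m h0 h p
    exact fun m p => ⟨aux μ κ hp m p, aux ν κ' hp' m p⟩

/-! ### Joining all first queries in one table. -/

/-- The strategy that replies to the first query `q`, if it has at most `c` bits, and to the
queries that follow by `g q`, and replies `halt` otherwise. -/
def ofFirst (c : ℕ) (g : List Bool → Message × ReplyTable) : ReplyTable
  | [] => .halt
  | q :: qs => if q.length ≤ c then (if qs = [] then (g q).1 else (g q).2 qs) else .halt

theorem measurable_ofFirst (c : ℕ) : Measurable (ofFirst c) := by
  refine measurable_pi_lambda _ fun qs => ?_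
  cases qs with
  | nil => exact measurable_const
  | cons q qs =>
    simp only [ofFirst]
    split_ifs
    · exact measurable_fst.comp (measurable_pi_apply q)
    · exact (measurable_pi_apply qs).comp (measurable_snd.comp (measurable_pi_apply q))
    · exact measurable_const

theorem follows_ofFirst {c : ℕ} {q : List Bool} (hq : q.length ≤ c) (m : Message)
    (p : List (List Bool × Message)) (g : List Bool → Message × ReplyTable) :
    Follows ((q, m) :: p) (ofFirst c g) ↔ (g q).1 = m ∧ (m = .halt ∨ Follows p (g q).2) := by
  have : Follows p ((ofFirst c g).shift q) ↔ Follows p (g q).2 :=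
    follows_congr fun qs hqs => by simp [ofFirst, shift, hq, hqs]
  simp only [Follows, this]
  simp [ofFirst, hq]

open Classical in
-- Settles the queries that bounded strategies refuse: those beyond the allowed number and those
-- that are too long.
theorem measure_follows_of_ae_halt {μ : Measure ReplyTable} [IsProbabilityMeasure μ]
    {q : List Bool} (h : ∀ᵐ f ∂μ, f [q] = .halt) (m : Message) (p : List (List Bool × Message)) :
    μ {f | Follows ((q, m) :: p) f} = if m = .halt then 1 else 0 := by
  split_ifs with hm
  · rw [prob_compl_eq_zero_iff (measurableSet_follows _) |>.symm]
    filter_upwards [h] with f hf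
    simp [Follows, hf, hm]
  · refine measure_mono_null (fun f hf => ?_) (ae_iff.1 h)
    have : f [q] = m := hf.1
    simpa [this] using hm

/-- Two bounded laws of strategies that are `d`-close against all adversaries agree along all
sequences of queries with two `d`-close laws of tables. -/
theorem IsClose.exists_tables (hcomplete : IsCompletePoset 𝒟) (hchain : D.ChainRule)
    (hcoupling : D.CouplingProperty) (n c : ℕ) {d : 𝒟} {μ ν : Measure ReplyTable}
    [IsProbabilityMeasure μ] [IsProbabilityMeasure ν] (h : IsClose D d μ ν)
    (hμ : ∀ᵐ f ∂μ, IsBounded n c f) (hν : ∀ᵐ f ∂ν, IsBounded n c f) :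
    ∃ τ τ' : Measure ReplyTable, IsProbabilityMeasure τ ∧ IsProbabilityMeasure τ' ∧
      D.dist τ τ' ≤ d ∧ PathEquiv τ μ ∧ PathEquiv τ' ν := by
  -- Provides the starting point of the coupling and the case without queries, where only constant
  -- tables are compared.
  have hdirac {β : Type} [MeasurableSpace β] (y : β) :
      D.dist (Measure.dirac y) (Measure.dirac y) ≤ d := by
    have hr := measurable_received_right halting
    have := Measure.isProbabilityMeasure_map (μ := μ) hr.aemeasurable
    have := Measure.isProbabilityMeasure_map (μ := ν) hr.aemeasurable
    exact GeneralizedDistance.dist_dirac_le (h halting) y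
  induction n generalizing d μ ν with
  | zero =>
    have aux (η : Measure ReplyTable) [IsProbabilityMeasure η] (hη : ∀ᵐ f ∂η, IsBounded 0 c f) :
        PathEquiv (Measure.dirac halting) η := by
      rintro (_ | ⟨⟨q, m⟩, p⟩)
      · simp [Follows]
      · rw [measure_follows_of_ae_halt, measure_follows_of_ae_halt]
        · filter_upwards [hη] with f hf using (hf [q] (by simp)).1 (by simp)
        · rw [ae_dirac_iff]
          · rfl
          · exact measurable_pi_apply [q] (measurableSet_singleton _)
    exact ⟨_, _, inferInstance, inferInstance, hdirac _, aux μ hμ, aux ν hν⟩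
  | succ n ih =>
    have hfin (η : Measure ReplyTable) (hη : ∀ᵐ f ∂η, IsBounded (n + 1) c f) (q : List Bool) :
        η.map (fun f => f [q]) {m | m.bitLength ≤ c}ᶜ = 0 := by
      rw [Measure.map_apply (measurable_eval [q]) .of_discrete]
      exact measure_mono_null (fun f hf (hfb : IsBounded _ _ f) => hf (hfb [q] (by simp)).2)
        (ae_iff.1 hη)
    choose ρ ρ' hρ1 hρ2 hle hρ using fun q : List Bool =>
      exists_reply_and_table hcomplete hchain h q
        ⟨_, finite_bitLength_le c, hfin μ hμ q, hfin ν hν q⟩ fun m e hm hm' he => by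
          have := isProbabilityMeasure_condShift hm
          have := isProbabilityMeasure_condShift hm'
          have hr := measurable_received_right halting
          have := Measure.isProbabilityMeasure_map (μ := condShift q m μ) hr.aemeasurable
          have := Measure.isProbabilityMeasure_map (μ := condShift q m ν) hr.aemeasurable
          exact ih he (ae_isBounded_condShift hμ) (ae_isBounded_condShift hν) fun y =>
            GeneralizedDistance.dist_dirac_le (he halting) y
    have hJ : {q : List Bool | q.length ≤ c}.Finite := List.finite_length_le Bool c
    -- Only queries of at most `c` bits need coupling, and there are finitely many; `ofFirst`
    -- answers longer ones by `halt`.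
    obtain ⟨σ, σ', hσ1, hσ2, hσle, hσ⟩ := hcoupling.finset
      ⟨(.halt, halting), hdirac _⟩ ρ ρ' hJ.toFinset fun q _ => hle q
    have aux (η : Measure ReplyTable) [IsProbabilityMeasure η]
        (hη : ∀ᵐ f ∂η, IsBounded (n + 1) c f) (ρ : List Bool → Measure (Message × ReplyTable))
        (hρ : ∀ q m p, ρ q {y | y.1 = m ∧ (m = .halt ∨ Follows p y.2)} =
          η {f | Follows ((q, m) :: p) f})
        (σ : Measure (List Bool → Message × ReplyTable)) [IsProbabilityMeasure σ]
        (hσ : ∀ q, q.length ≤ c → σ.map (fun g => g q) = ρ q) :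
        PathEquiv (σ.map (ofFirst c)) η := by
      have := Measure.isProbabilityMeasure_map (μ := σ) (measurable_ofFirst c).aemeasurable
      rintro (_ | ⟨⟨q, m⟩, p⟩)
      · simp [Follows]
      by_cases hq : q.length ≤ c
      · rw [← hρ, ← hσ q hq, Measure.map_apply (measurable_ofFirst c) (measurableSet_follows _),
          Measure.map_apply (measurable_pi_apply q)]
        · congr 1
          ext g
          exact follows_ofFirst hq m p g
        · exact (measurable_fst (measurableSet_singleton m)).inter
            ((MeasurableSet.const _).union (measurable_snd (measurableSet_follows p)))
      · rw [measure_follows_of_ae_halt, measure_follows_of_ae_halt]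
        · filter_upwards [hη] with f hf
            using (hf [q] (by simp)).1 (.inr ⟨q, by simp, by simpa using hq⟩)
        · rw [ae_map_iff (measurable_ofFirst c).aemeasurable
            (measurableSet_eq_fun (measurable_eval [q]) measurable_const)]
          exact .of_forall fun g => by simp [ofFirst, hq]
    exact ⟨σ.map (ofFirst c), σ'.map (ofFirst c),
      Measure.isProbabilityMeasure_map (measurable_ofFirst c).aemeasurable,
      Measure.isProbabilityMeasure_map (measurable_ofFirst c).aemeasurable,
      (D.post_processing σ σ' _ (measurable_ofFirst c)).trans hσle,
      aux μ hμ ρ (fun q m p => (hρ q m p).1) σ fun q hq => (hσ q (by simpa using hq)).1,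
      aux ν hν ρ' (fun q m p => (hρ q m p).2) σ' fun q hq => (hσ q (by simpa using hq)).2⟩

end ReplyTable

/-! ### Back to mechanisms and to adversaries with coins. -/

namespace InteractiveMechanism

open ReplyTable

variable {X : Type*} {𝒟 : Type*} [PartialOrder 𝒟] {D : GeneralizedDistance 𝒟}

instance (B : Adversary) (M : InteractiveMechanism X) (x : X) :
    IsProbabilityMeasure (view B M x) :=
  Measure.isProbabilityMeasure_map (measurable_fst.prodMk (measurable_received B M x)).aemeasurable

theorem IsDP.isClose {M : InteractiveMechanism X} {nbr : X → X → Prop} {d : 𝒟}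
    (h : M.IsDP D nbr d) {x x' : X} (hx : nbr x x') :
    IsClose D d (M.tableLaw x) (M.tableLaw x') := fun b => by
  rw [← map_snd_view_ofTable, ← map_snd_view_ofTable]
  exact (D.post_processing _ _ _ measurable_snd).trans (h (.ofTable b) x x' hx)

/-- The bound depends on the dataset; allowing every larger `c` lets two neighbors share one. A
single reply is bounded as the last term of the total. -/
theorem FiniteCommunication.exists_ae_isBounded {M : InteractiveMechanism X}
    (h : M.FiniteCommunication) (x : X) :
    ∃ c₀, ∀ c, c₀ ≤ c → ∀ᵐ f ∂M.tableLaw x, IsBounded c c f := by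
  obtain ⟨c₀, hc₀⟩ := h x
  refine ⟨c₀, fun c hc => ?_⟩
  rw [tableLaw, ae_map_iff (M.measurable_table x).aemeasurable (measurableSet_isBounded c c)]
  refine .of_forall fun r qs hqs => ?_
  obtain ⟨h1, h2⟩ := hc₀ r qs
  refine ⟨fun hlong => h1 ?_, ?_⟩
  · rcases hlong with hn | ⟨q, hq, hqc⟩
    · exact .inl (hc.trans_lt hn)
    · exact .inr ⟨q, hq, hc.trans_lt hqc⟩
  · change (M.reply x qs r).bitLength ≤ c
    by_cases hlong : c₀ < qs.length ∨ ∃ q ∈ qs, c₀ < q.length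
    · simp [h1 hlong, Message.bitLength]
    · push Not at hlong
      have hlen : 0 < qs.length := List.length_pos_iff.2 hqs
      have hlast : qs.take (qs.length - 1 + 1) = qs := by
        rw [Nat.sub_add_cancel hlen, List.take_length]
      have := Finset.single_le_sum (s := Finset.range qs.length)
        (f := fun j => (M.reply x (qs.take (j + 1)) r).bitLength) (fun _ _ => Nat.zero_le _)
        (Finset.mem_range.2 (Nat.sub_lt hlen one_pos))
      simp only [hlast] at this
      exact (this.trans (h2 hlong)).trans hc

/-- The view of every adversary is a post-processing of any law of tables that is observably equal
to the law of the strategies of the mechanism. -/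
theorem dist_view_le {Y : Type} [MeasurableSpace Y] (M : InteractiveMechanism X) {x x' : X} {d : 𝒟}
    {τ τ' : Measure Y} [IsProbabilityMeasure τ] [IsProbabilityMeasure τ'] (h : D.dist τ τ' ≤ d)
    {g : Y → ReplyTable} (hg : Measurable g) (hτ : PathEquiv (τ.map g) (M.tableLaw x))
    (hτ' : PathEquiv (τ'.map g) (M.tableLaw x')) (B : Adversary) :
    D.dist (view B M x) (view B M x') ≤ d := by
  rw [← bind_viewKernel, ← bind_viewKernel]
  -- The random index is the coin of `B`; for each fixed coin the view is a function of the table.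
  refine D.joint_convexity _ _ _ d fun rB => ?_
  have := Measure.isProbabilityMeasure_map (μ := τ) hg.aemeasurable
  have := Measure.isProbabilityMeasure_map (μ := τ') hg.aemeasurable
  have hr := measurable_received_right (B.table rB)
  rw [viewKernel_apply, viewKernel_apply, ← hτ.map_received_eq, ← hτ'.map_received_eq,
    Measure.map_map hr hg, Measure.map_map hr hg,
    Measure.map_map measurable_prodMk_left (hr.comp hg),
    Measure.map_map measurable_prodMk_left (hr.comp hg)]
  exact (D.post_processing _ _ _ (measurable_prodMk_left.comp (hr.comp hg))).trans h

end InteractiveMechanism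

open InteractiveMechanism ReplyTable in
theorem mainTheorem5 {𝒟 : Type*} [PartialOrder 𝒟] (D : GeneralizedDistance 𝒟)
    (hcomplete : IsCompletePoset 𝒟) (hchain : D.ChainRule) (hcoupling : D.CouplingProperty)
    {k : ℕ} (d : Fin k → 𝒟) (dtot : 𝒟)
    (hcomp : ∀ (𝒳 : Type) (nbr : 𝒳 → 𝒳 → Prop) (N : Fin k → NonInteractiveMechanism 𝒳),
      (∀ j, (N j).IsDP D nbr (d j)) → (NonInteractiveMechanism.comp N).IsDP D nbr dtot)
    (parse : List Bool → Option (Fin k × List Bool))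
    {X : Fin k → Type*} (nbr : ∀ j, X j → X j → Prop)
    (M : ∀ j, InteractiveMechanism (X j))
    (hfin : ∀ j, (M j).FiniteCommunication)
    (hM : ∀ j, (M j).IsDP D (nbr j) (d j)) :
    (InteractiveMechanism.conComp parse M).IsDP D
      (fun x x' => ∀ j, nbr j (x j) (x' j)) dtot := by
  intro B x x' hx
  have htables (j : Fin k) : ∃ τ τ' : Measure ReplyTable, IsProbabilityMeasure τ ∧
      IsProbabilityMeasure τ' ∧ D.dist τ τ' ≤ d j ∧ PathEquiv τ ((M j).tableLaw (x j)) ∧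
      PathEquiv τ' ((M j).tableLaw (x' j)) := by
    obtain ⟨c, hc⟩ := (hfin j).exists_ae_isBounded (x j)
    obtain ⟨c', hc'⟩ := (hfin j).exists_ae_isBounded (x' j)
    exact ((hM j).isClose (hx j)).exists_tables hcomplete hchain hcoupling _ _
      (hc _ (le_max_left c c')) (hc' _ (le_max_right c c'))
  choose τ τ' hτ1 hτ2 hle hτ hτ' using htables
  -- The dataset `false` stands for `x` and `true` for `x'`, with this ordered pair as the only
  -- neighbors, since closeness is known in this order only.
  let N (j : Fin k) : NonInteractiveMechanism Bool :=
    { Out := ReplyTable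
      law := fun b => if b then τ' j else τ j
      isProbabilityMeasure := fun b => by cases b <;> simp [hτ1, hτ2] }
  have hN := hcomp Bool (fun b b' => b = false ∧ b' = true) N
    (by rintro j _ _ ⟨rfl, rfl⟩; exact hle j) false true ⟨rfl, rfl⟩
  have hpi : D.dist (Measure.pi τ) (Measure.pi τ') ≤ dtot := hN
  refine dist_view_le (conComp parse M) hpi (measurable_conc parse) ?_ ?_ B
  · rw [tableLaw_conComp]
    exact PathEquiv.conc parse hτ
  · rw [tableLaw_conComp]
    exact PathEquiv.conc parse hτ'
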